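/- A word over a finite alphabet is \emph{cube-free} if it has no factor of the form $xxx$ with $x$ a nonempty word; the same definition applies to infinite words. A finite cube-free word $u$ over the binary alphabet $\Sigma_2=\{a,b\}$ is \emph{right extendable} if there is an infinite word $\mathbf{s}=s_0s_1s_2\cdots$ over $\Sigma_2$ such that the infinite word $u\mathbf{s}$ is cube-free. A finite cube-free word $v$ over $\Sigma_2$ is \emph{left extendable} if there is a left-infinite word $\mathbf{s}=\cdots s_2s_1s_0$ over $\Sigma_2$ such that the left-infinite word $\mathbf{s}v$ is cube-free. \textbf{Theorem.} For every pair $(u,v)$ of finite binary cube-free words such that $u$ is right extendable and $v$ is left extendable, there exists a finite (possibly empty) word $w$ over $\Sigma_2$ such that $uwv$ is cube-free. -/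

import Mathlib

namespace CubeFreeWords

variable {α : Type*}

/-- A finite word is cube-free if no word `x ++ x ++ x` with `x` nonempty is a factor of it. -/
def CubeFree (w : List α) : Prop :=
  ∀ x : List α, x ≠ [] → ¬ (x ++ x ++ x) <:+: w

/-- The finite word `x` is a factor of the infinite word `s = s₀ s₁ s₂ ⋯`. -/
def IsFactorOfRightInfinite (x : List α) (s : Stream' α) : Prop :=
  ∃ i : ℕ, (s.drop i).take x.length = x

/-- The finite word `x` is a factor of the left-infinite word `⋯ s₂ s₁ s₀`
(letters are numbered from right to left). -/
def IsFactorOfLeftInfinite (x : List α) (s : Stream' α) : Prop :=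
  ∃ i : ℕ, ((s.drop i).take x.length).reverse = x

/-- The infinite word `s₀ s₁ s₂ ⋯` has no cubes as factors. -/
def RightInfiniteCubeFree (s : Stream' α) : Prop :=
  ∀ x : List α, x ≠ [] → ¬ IsFactorOfRightInfinite (x ++ x ++ x) s

/-- The left-infinite word `⋯ s₂ s₁ s₀` has no cubes as factors. -/
def LeftInfiniteCubeFree (s : Stream' α) : Prop :=
  ∀ x : List α, x ≠ [] → ¬ IsFactorOfLeftInfinite (x ++ x ++ x) s

/-- `u` is right extendable: there is an infinite word `s = s₀ s₁ s₂ ⋯` (an infinite right context)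
such that the infinite word `u s₀ s₁ s₂ ⋯` is cube-free. -/
def RightExtendable (u : List α) : Prop :=
  ∃ s : Stream' α, RightInfiniteCubeFree (u ++ₛ s)

/-- `v` is left extendable: there is a left-infinite word `⋯ s₂ s₁ s₀` (an infinite left context)
such that the left-infinite word `⋯ s₂ s₁ s₀ v` is cube-free. Since left-infinite words are
numbered from right to left, the latter is the stream `v.reverse ++ₛ s`. -/
def LeftExtendable (v : List α) : Prop :=
  ∃ s : Stream' α, LeftInfiniteCubeFree (v.reverse ++ₛ s)

end CubeFreeWords

/-!
The idea is to leave a right context of `u`, at a well-chosen moment, for the Thue–Morse word, to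
do the same on the left of `v`, and to join the two Thue–Morse contexts.

Let `W = u s` be an infinite cube-free word, and let `z` be a Thue–Morse factor ending a prefix `p`
of `W`, say at positions `[a, a + l)`. Continue `p` by some `t` such that `z t` is still a
Thue–Morse factor, and suppose that `p t` contains a cube of period `q`. Thue–Morse factors are
overlap-free, so at most `2 q` letters of the cube lie to the right of `a`; in other words its first
period lies to the left of `a`. Hence the part of the cube from `a` on, which contains `z` and at
least one letter of `t`, has a copy `q` positions to the left: `z` was preceded in `W` by a
Thue–Morse factor that is longer than `z`. A suitable choice of `z` excludes this
(`IsOverlapFreeLanguage.exists_take`). If `W` has Thue–Morse factors of every length, let `z` be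
the first one of length `|u|`. Otherwise let `l + 1` be the least length of Thue–Morse factors
that no longer occur from some position `N` on, and take `z` of length `l` far beyond `N`: then the
copy has to start before `N`, but it is so long that it contains a Thue–Morse factor of length
`l + 1` at position `N`.

The mirror image of this argument serves `v`. As the Thue–Morse word is recurrent, the two ends can
be joined by a Thue–Morse factor `t` as long as desired
(`exists_isThueMorseFactor_append`). A new cube would cover `t` and have a period shorter than half
of `t`, so `t` would contain an overlap (`IsOverlapFreeLanguage.cubeFree_glue`).

The first steps use nothing about the Thue–Morse word beyond overlap-freeness, so they are stated
for any factor-closed language of overlap-free words; this also makes them applicable to the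
reversed language.
-/

namespace CubeFreeWords

variable {α : Type*}

/-! ### Cubes in terms of positions -/

theorem cubeFree_iff_getElem? {w : List α} :
    CubeFree w ↔ ∀ i q, 0 < q → i + 3 * q ≤ w.length →
      ∃ j < 2 * q, w[i + j]? ≠ w[i + j + q]? := by
  constructor
  · intro h i q hq hi
    by_contra! hper
    refine h ((w.drop i).take q) (by simp; omega) ⟨w.take i, w.drop (i + 3 * q), ?_⟩
    have hlen : ((w.drop i).take q).length = q := by simp; omega
    have h1 : (w.drop i).take q = (w.drop (i + q)).take q := by
      apply List.ext_getElem?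
      intro j
      by_cases hj : j < q
      · have := hper j (by omega)
        simp only [List.getElem?_take, List.getElem?_drop, hj, if_true, this]
        congr 1; omega
      · simp [hj]
    have h2 : (w.drop i).take q = (w.drop (i + 2 * q)).take q := by
      rw [h1]
      apply List.ext_getElem?
      intro j
      by_cases hj : j < q
      · have := hper (q + j) (by omega)
        simp only [List.getElem?_take, List.getElem?_drop, hj, if_true]
        rw [show i + q + j = i + (q + j) by omega, this]
        congr 1; omega
      · simp [hj]
    have split (d : ℕ) : (w.drop d).take q ++ w.drop (d + q) = w.drop d := by
      rw [← List.drop_drop, List.take_append_drop]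
    calc w.take i ++ ((w.drop i).take q ++ (w.drop i).take q ++ (w.drop i).take q) ++
          w.drop (i + 3 * q)
        = w.take i ++ ((w.drop i).take q ++ ((w.drop (i + q)).take q ++
            ((w.drop (i + 2 * q)).take q ++ w.drop (i + 2 * q + q)))) := by
          rw [← h1, ← h2, show i + 2 * q + q = i + 3 * q by omega]; simp
      _ = w := by
          rw [split, show i + 2 * q = i + q + q by omega, split, split, List.take_append_drop]
  · rintro h x hx ⟨s, e, rfl⟩
    obtain ⟨j, hj, hne⟩ := h s.length x.length (List.length_pos_iff.2 hx) (by simp; omega)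
    apply hne
    simp only [List.getElem?_append, List.length_append]
    grind

theorem CubeFree.of_infix {w w' : List α} (h : CubeFree w) (hw : w' <:+: w) : CubeFree w' :=
  fun x hx hc => h x hx (hc.trans hw)

theorem CubeFree.reverse {w : List α} (h : CubeFree w) : CubeFree w.reverse := by
  intro x hx hc
  refine h x.reverse (by simpa using hx) ?_
  rw [← List.reverse_infix]
  simpa using hc

theorem RightInfiniteCubeFree.cubeFree_take {s : Stream' α} (h : RightInfiniteCubeFree s)
    (n : ℕ) : CubeFree (s.take n) := by
  rintro x hx ⟨y, e, hye⟩
  refine h x hx ⟨y.length, ?_⟩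
  have hlen := congrArg List.length hye
  simp only [List.length_append, Stream'.length_take] at hlen
  apply List.ext_getElem?
  intro j
  by_cases hj : j < (x ++ x ++ x).length
  · have hj' : y.length + j < n := by simp at hj; omega
    rw [Stream'.getElem?_take hj, Stream'.get_drop, ← Stream'.getElem?_take hj', ← hye]
    rw [List.append_assoc, List.getElem?_append_right (by omega),
      List.getElem?_append_left (by omega)]
    congr 1; omega
  · rw [List.getElem?_eq_none (by simpa using hj), List.getElem?_eq_none (by simpa using hj)]

theorem LeftExtendable.rightExtendable_reverse {v : List α} (h : LeftExtendable v) :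
    RightExtendable v.reverse := by
  obtain ⟨s, hs⟩ := h
  refine ⟨s, fun x hx ⟨i, hi⟩ => hs x.reverse (by simpa using hx) ⟨i, ?_⟩⟩
  rw [show (x.reverse ++ x.reverse ++ x.reverse) = (x ++ x ++ x).reverse by simp,
    List.length_reverse, hi]

/-! ### Extending into a language of overlap-free words -/

/-- A factor-closed language, containing the empty word, all of whose words are overlap-free:
no word of the language has a prefix of length `2 * q + 1` with period `q > 0`. Closure under
factors makes it enough to look at prefixes. -/
structure IsOverlapFreeLanguage (F : List α → Prop) : Prop where
  nil : F []
  of_infix : ∀ {x y : List α}, x <:+: y → F y → F x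
  overlapFree : ∀ {z : List α} {q : ℕ}, F z → 0 < q → 2 * q < z.length →
    ∃ j ≤ q, z[j]? ≠ z[j + q]?

theorem IsOverlapFreeLanguage.reverse {F : List α → Prop} (hF : IsOverlapFreeLanguage F) :
    IsOverlapFreeLanguage fun z => F z.reverse where
  nil := hF.nil
  of_infix h hy := hF.of_infix (List.reverse_infix.2 h) hy
  overlapFree := by
    intro z q hz hq hlen
    -- The prefix of `z` of length `2 * q + 1`, reversed, is a word of the language.
    have hz' : F (z.take (2 * q + 1)).reverse :=
      hF.of_infix (List.reverse_infix.2 (List.take_prefix _ _).isInfix) hz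
    have hl : (z.take (2 * q + 1)).length = 2 * q + 1 := by simp; omega
    obtain ⟨j, hj, hne⟩ := hF.overlapFree hz' hq (by simp; omega)
    refine ⟨q - j, by omega, fun h => hne ?_⟩
    rw [List.getElem?_reverse (by omega), List.getElem?_reverse (by omega), hl,
      List.getElem?_take_of_lt (by omega), List.getElem?_take_of_lt (by omega),
      show 2 * q + 1 - 1 - j = q - j + q by omega, show 2 * q + 1 - 1 - (j + q) = q - j by omega, h]

/-- In a word whose suffix from position `a` on lies in an overlap-free language, a cube of
period `q` starting at `i` keeps its first period before `a`. -/
theorem IsOverlapFreeLanguage.add_le_of_cube {F : List α → Prop} (hF : IsOverlapFreeLanguage F)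
    {w : List α} {a i q : ℕ} (hw : F (w.drop a)) (hq : 0 < q) (hi : i + 3 * q ≤ w.length)
    (hper : ∀ j < 2 * q, w[i + j]? = w[i + j + q]?) : i + q ≤ a := by
  by_contra! hlt
  have hm : F (w.drop (max i a)) := by
    refine hF.of_infix ?_ hw
    rw [show max i a = a + (max i a - a) by omega, ← List.drop_drop]
    exact (List.drop_suffix _ _).isInfix
  obtain ⟨j, hj, hne⟩ := hF.overlapFree hm hq (by simp; omega)
  apply hne
  have := hper (max i a - i + j) (by omega)
  rw [List.getElem?_drop, List.getElem?_drop]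
  convert this using 2 <;> omega

/-- The part of a cube to the right of `a` reappears one period to the left, so factors there
belong to the language as well. -/
theorem IsOverlapFreeLanguage.mem_of_cube {F : List α → Prop} (hF : IsOverlapFreeLanguage F)
    {w : List α} {a i q c l : ℕ} (hw : F (w.drop a))
    (hper : ∀ j < 2 * q, w[i + j]? = w[i + j + q]?) (hc : i ≤ c) (hca : a ≤ c + q)
    (hl : c + l ≤ i + 2 * q) : F ((w.drop c).take l) := by
  have heq : (w.drop c).take l = (w.drop (c + q)).take l := by
    apply List.ext_getElem?
    intro j
    by_cases hj : j < l
    · have := hper (c - i + j) (by omega)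
      simp only [List.getElem?_take, List.getElem?_drop, hj, if_true]
      convert this using 2 <;> omega
    · simp [hj]
  rw [heq]
  refine hF.of_infix ((List.take_prefix _ _).isInfix.trans ?_) hw
  rw [show c + q = a + (c + q - a) by omega, ← List.drop_drop]
  exact (List.drop_suffix _ _).isInfix

theorem take_drop_take_append (W : Stream' α) (t : List α) {n c l : ℕ} (h : c + l ≤ n) :
    ((W.take n ++ t).drop c).take l = (W.drop c).take l := by
  apply List.ext_getElem?
  intro j
  by_cases hj : j < l
  · rw [List.getElem?_take_of_lt hj, List.getElem?_drop,
      List.getElem?_append_left (by simp; omega), Stream'.getElem?_take (by omega),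
      Stream'.getElem?_take hj, Stream'.get_drop]
  · simp [hj]

/-- A cube-free infinite word has arbitrarily long prefixes `p`, ending in a word `z` of the
given overlap-free language, such that `p` may be continued by every `t` for which `z ++ t` stays
in the language. -/
theorem IsOverlapFreeLanguage.exists_take {F : List α → Prop} (hF : IsOverlapFreeLanguage F)
    {W : Stream' α} (hW : ∀ n, CubeFree (W.take n)) (m : ℕ) :
    ∃ a l, m ≤ a + l ∧ F ((W.drop a).take l) ∧
      ∀ t, F ((W.drop a).take l ++ t) → CubeFree (W.take (a + l) ++ t) := by
  classical
  -- It suffices that a cube reaching beyond `a + l` cannot have its first period before `a`.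
  suffices H : ∃ a l, m ≤ a + l ∧ F ((W.drop a).take l) ∧
      ∀ t i q, F ((W.take (a + l) ++ t).drop a) → i + q ≤ a → a + l < i + 3 * q →
        ¬ ∀ j < 2 * q, (W.take (a + l) ++ t)[i + j]? = (W.take (a + l) ++ t)[i + j + q]? by
    obtain ⟨a, l, hm, hFl, H⟩ := H
    refine ⟨a, l, hm, hFl, fun t ht => cubeFree_iff_getElem?.2 fun i q hq hi => ?_⟩
    by_contra! hper
    have ht' : F ((W.take (a + l) ++ t).drop a) := by
      rw [Stream'.take_add, List.append_assoc]
      simpa using ht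
    have hia := hF.add_le_of_cube ht' hq hi hper
    by_cases hin : a + l < i + 3 * q
    · exact H t i q ht' hia hin hper
    · obtain ⟨j, hj, hne⟩ := cubeFree_iff_getElem?.1 (hW (a + l)) i q hq (by simp; omega)
      have := hper j hj
      rw [List.getElem?_append_left (by simp; omega),
        List.getElem?_append_left (by simp; omega)] at this
      exact hne this
  by_cases hbdd : ∃ l N, ∀ b, N ≤ b → ¬ F ((W.drop b).take l)
  · -- `l + 1` is the least length of words of `F` that `W` eventually avoids.
    obtain ⟨N, hN⟩ := Nat.find_spec hbdd
    have hmin := fun l => Nat.find_min hbdd (m := l)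
    generalize Nat.find hbdd = L at hN hmin
    obtain _ | l := L
    · exact absurd hF.nil (by simpa using hN N le_rfl)
    have hinf := hmin l (by omega)
    push Not at hinf
    -- The bound on `a` leaves room, inside a cube that starts before `N`, for a word of length
    -- `l + 1` at position `N`.
    obtain ⟨a, ha, hFa⟩ := hinf (m + 2 * N + l + 1)
    refine ⟨a, l, by omega, hFa, fun t i q ht hia hend hper => ?_⟩
    by_cases hb : N ≤ a - q
    · apply hN (a - q) hb
      rw [← take_drop_take_append W t (n := a + l) (by omega)]
      exact hF.mem_of_cube ht hper (by omega) (by omega) (by omega)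
    · apply hN N le_rfl
      rw [← take_drop_take_append W t (n := a + l) (by omega)]
      exact hF.mem_of_cube ht hper (by omega) (by omega) (by omega)
  · -- Words of `F` of every length occur; take the first one of length `m`.
    push Not at hbdd
    have hex : ∃ b, F ((W.drop b).take m) := by
      obtain ⟨b, -, hb⟩ := hbdd m 0
      exact ⟨b, hb⟩
    refine ⟨Nat.find hex, m, by omega, Nat.find_spec hex, fun t i q ht hia hend hper => ?_⟩
    have hq : 0 < q := by omega
    apply Nat.find_min hex (m := Nat.find hex - q) (by omega)
    rw [← take_drop_take_append W t (n := Nat.find hex + m) (by omega)]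
    exact hF.mem_of_cube ht hper (by omega) (by omega) (by omega)

theorem RightExtendable.exists_append {F : List α → Prop} (hF : IsOverlapFreeLanguage F)
    {u : List α} (hu : RightExtendable u) :
    ∃ x z, F z ∧ ∀ t, F (z ++ t) → CubeFree (u ++ x ++ t) := by
  obtain ⟨s, hs⟩ := hu
  obtain ⟨a, l, hm, hz, h⟩ := hF.exists_take hs.cubeFree_take u.length
  have hp : (u ++ₛ s).take (a + l) = u ++ s.take (a + l - u.length) := by
    rw [Stream'.append_take]
    congr 1; omega
  refine ⟨_, _, hz, fun t ht => hp ▸ h t ht⟩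

/-- Two cube-free words sharing a long overlap-free factor `t` can be glued along it: a cube of
`p ++ t ++ r` not inside `p ++ t` or `t ++ r` covers `t`, and its period is less than half of the
length of `t`. -/
theorem IsOverlapFreeLanguage.cubeFree_glue {F : List α → Prop} (hF : IsOverlapFreeLanguage F)
    {p t r : List α} (hpt : CubeFree (p ++ t)) (htr : CubeFree (t ++ r)) (ht : F t)
    (hlen : 2 * (p.length + r.length) < t.length) : CubeFree (p ++ t ++ r) := by
  rw [cubeFree_iff_getElem?] at hpt htr ⊢
  intro i q hq hi
  by_contra! hper
  have hl (n : ℕ) (hn : n < p.length + t.length) : (p ++ t ++ r)[n]? = (p ++ t)[n]? :=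
    List.getElem?_append_left (by simpa using hn)
  have hr (n : ℕ) (hn : p.length ≤ n) : (p ++ t ++ r)[n]? = (t ++ r)[n - p.length]? := by
    rw [List.append_assoc, List.getElem?_append_right hn]
  simp only [List.length_append] at hi hpt htr
  by_cases h1 : i + 3 * q ≤ p.length + t.length
  · obtain ⟨j, hj, hne⟩ := hpt i q hq h1
    apply hne
    rw [← hl _ (by omega), ← hl _ (by omega), hper j hj]
  by_cases h2 : p.length ≤ i
  · obtain ⟨j, hj, hne⟩ := htr (i - p.length) q hq (by omega)
    have := hper j hj
    rw [hr _ (by omega), hr _ (by omega)] at this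
    apply hne
    convert this using 2 <;> omega
  obtain ⟨j, hj, hne⟩ := hF.overlapFree ht hq (by omega)
  have := hper (p.length - i + j) (by omega)
  rw [show i + (p.length - i + j) = p.length + j by omega, hr _ (by omega), hr _ (by omega),
    List.getElem?_append_left (by omega), List.getElem?_append_left (by omega)] at this
  apply hne
  convert this using 2 <;> omega

/-! ### The Thue–Morse word -/

/-- The Thue–Morse word: its letter at position `n` is the parity of the sum of the binary digits
of `n`. -/
def thueMorse : Stream' (Fin 2) := fun n => Fin.ofNat 2 (Nat.digits 2 n).sum

theorem thueMorse_two_mul (n : ℕ) : thueMorse.get (2 * n) = thueMorse.get n := by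
  rcases Nat.eq_zero_or_pos n with rfl | hn
  · rfl
  · simp [thueMorse, Stream'.get, Nat.digits_base_mul one_lt_two hn]

theorem thueMorse_two_mul_add_one (n : ℕ) :
    thueMorse.get (2 * n + 1) = 1 + thueMorse.get n := by
  have h : Nat.digits 2 (2 * n + 1) = 1 :: Nat.digits 2 n := by
    rw [add_comm]
    exact Nat.digits_add 2 one_lt_two 1 n one_lt_two (by simp)
  ext
  simp only [thueMorse, Stream'.get, h]
  simp [Fin.val_add]

theorem thueMorse_ne_of_even {n : ℕ} (hn : Even n) :
    thueMorse.get n ≠ thueMorse.get (n + 1) := by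
  obtain ⟨k, rfl⟩ := hn
  rw [← two_mul, thueMorse_two_mul, thueMorse_two_mul_add_one]
  generalize thueMorse.get k = x
  revert x; decide

theorem fin_two_eq_iff_of_ne {x y z : Fin 2} (h : x ≠ y) : y = z ↔ x ≠ z := by
  revert x y z; decide

/-- The Thue–Morse word is overlap-free. An even period is halved by passing to the positions of
the parity of `i`. With an odd period, one of any two neighbouring letters and its copy is at an
even position, so neighbouring letters differ, which contradicts the odd period. -/
theorem thueMorse_overlapFree (q : ℕ) (hq : 0 < q) (i : ℕ) :
    ∃ j ≤ q, thueMorse.get (i + j) ≠ thueMorse.get (i + j + q) := by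
  induction q using Nat.strong_induction_on generalizing i with
  | _ q ih =>
    by_contra! h
    rcases Nat.even_or_odd' q with ⟨k, rfl | rfl⟩
    · obtain ⟨j, hj, hne⟩ := ih k (by omega) (by omega) (i / 2)
      apply hne
      have h2 := h (2 * j) (by omega)
      rcases Nat.even_or_odd' i with ⟨c, rfl | rfl⟩
      · rw [show 2 * c + 2 * j + 2 * k = 2 * (c + j + k) by omega, ← mul_add, thueMorse_two_mul,
          thueMorse_two_mul] at h2
        convert h2 using 3 <;> omega
      · rw [show 2 * c + 1 + 2 * j + 2 * k = 2 * (c + j + k) + 1 by omega,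
          show 2 * c + 1 + 2 * j = 2 * (c + j) + 1 by omega, thueMorse_two_mul_add_one,
          thueMorse_two_mul_add_one] at h2
        convert add_left_cancel h2 using 3 <;> omega
    · have hstep : ∀ j < 2 * k + 1, thueMorse.get (i + j) ≠ thueMorse.get (i + j + 1) := by
        intro j hj
        rcases Nat.even_or_odd (i + j) with he | ho
        · exact thueMorse_ne_of_even he
        · have h1 := h j (by omega)
          have h2 := h (j + 1) (by omega)
          rw [← add_assoc] at h2
          rw [h1, h2, show i + j + 1 + (2 * k + 1) = i + j + (2 * k + 1) + 1 by omega]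
          exact thueMorse_ne_of_even (ho.add_odd ⟨k, rfl⟩)
      have halt : ∀ c ≤ k, thueMorse.get i = thueMorse.get (i + 2 * c) := by
        intro c
        induction c with
        | zero => simp
        | succ c ihc =>
          intro hc
          have h1 := hstep (2 * c) (by omega)
          have h2 := hstep (2 * c + 1) (by omega)
          rw [ihc (by omega), eq_comm, ← add_assoc] at *
          rw [show i + 2 * (c + 1) = i + 2 * c + 1 + 1 by omega]
          by_contra hne
          exact h2 ((fin_two_eq_iff_of_ne h1).2 (by tauto))
      have h1 := hstep (2 * k) (by omega)
      have h0 := h 0 (by omega)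
      rw [← halt k le_rfl] at h1
      exact h1 (by simpa [add_assoc] using h0)

/-- Every prefix of the Thue–Morse word, here of length `2 ^ m`, recurs arbitrarily far to the
right. -/
theorem thueMorse_recurrent (m N : ℕ) :
    ∃ c, N ≤ c ∧ ∀ j < 2 ^ m, thueMorse.get (c + j) = thueMorse.get j := by
  induction m generalizing N with
  | zero =>
    have hne := thueMorse_ne_of_even (even_two_mul N)
    by_cases h : thueMorse.get (2 * N) = thueMorse.get 0
    · refine ⟨2 * N, by omega, fun j hj => ?_⟩
      obtain rfl : j = 0 := by omega
      exact h
    · refine ⟨2 * N + 1, by omega, fun j hj => ?_⟩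
      obtain rfl : j = 0 := by omega
      exact (fin_two_eq_iff_of_ne hne).2 h
  | succ m ih =>
    obtain ⟨c, hc, h⟩ := ih N
    refine ⟨2 * c, by omega, fun j hj => ?_⟩
    rw [pow_succ] at hj
    rcases Nat.even_or_odd' j with ⟨d, rfl | rfl⟩
    · rw [← mul_add, thueMorse_two_mul, thueMorse_two_mul, h d (by omega)]
    · rw [← add_assoc, ← mul_add, thueMorse_two_mul_add_one, thueMorse_two_mul_add_one,
        h d (by omega)]

/-- The language of factors of the Thue–Morse word. -/
def IsThueMorseFactor (z : List (Fin 2)) : Prop :=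
  ∃ k, (thueMorse.drop k).take z.length = z

theorem isThueMorseFactor_take_drop (k l : ℕ) :
    IsThueMorseFactor ((thueMorse.drop k).take l) := ⟨k, by simp⟩

theorem isOverlapFreeLanguage_isThueMorseFactor : IsOverlapFreeLanguage IsThueMorseFactor where
  nil := ⟨0, rfl⟩
  of_infix := by
    rintro x y ⟨s, e, rfl⟩ ⟨k, hk⟩
    refine ⟨k + s.length, ?_⟩
    rw [List.length_append, List.length_append, Stream'.take_add, Stream'.take_add,
      Stream'.drop_drop] at hk
    exact (List.append_inj (List.append_inj hk (by simp)).1 (by simp)).2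
  overlapFree := by
    rintro z q ⟨k, hk⟩ hq hlen
    obtain ⟨j, hj, hne⟩ := thueMorse_overlapFree q hq k
    refine ⟨j, hj, fun h => hne ?_⟩
    rw [← hk, Stream'.getElem?_take (by omega), Stream'.getElem?_take (by omega),
      Stream'.get_drop, Stream'.get_drop] at h
    simpa [add_assoc] using h

/-- Any two Thue–Morse factors are joined by arbitrarily long words inside the language. -/
theorem exists_isThueMorseFactor_append {x y : List (Fin 2)} (hx : IsThueMorseFactor x)
    (hy : IsThueMorseFactor y) (n : ℕ) :
    ∃ t, n ≤ t.length ∧ IsThueMorseFactor (x ++ t ++ y) := by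
  obtain ⟨k, hk⟩ := hx
  obtain ⟨k', hk'⟩ := hy
  obtain ⟨c, hc, hrec⟩ := thueMorse_recurrent (k' + y.length) (k + x.length + n)
  have hy' : (thueMorse.drop (c + k')).take y.length = y := by
    rw [← hk', Stream'.length_take]
    apply List.ext_getElem?
    intro j
    by_cases hj : j < y.length
    · rw [Stream'.getElem?_take hj, Stream'.getElem?_take hj, Stream'.get_drop, Stream'.get_drop,
        add_assoc, hrec _ ((by omega : k' + j < k' + y.length).trans Nat.lt_two_pow_self)]
    · simp [hj]
  obtain ⟨d, hd⟩ := Nat.exists_eq_add_of_le (show k + x.length ≤ c + k' by omega)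
  refine ⟨(thueMorse.drop (k + x.length)).take d, by simp; omega, ?_⟩
  have := isThueMorseFactor_take_drop k (x.length + d + y.length)
  rwa [Stream'.take_add, Stream'.take_add, Stream'.drop_drop, Stream'.drop_drop, hk,
    ← add_assoc, ← hd, hy'] at this

end CubeFreeWords

open CubeFreeWords in
theorem theorem1 (u v : List (Fin 2))
    (hu : CubeFreeWords.CubeFree u) (hv : CubeFreeWords.CubeFree v)
    (hur : CubeFreeWords.RightExtendable u) (hvl : CubeFreeWords.LeftExtendable v) :
    ∃ w : List (Fin 2), CubeFreeWords.CubeFree (u ++ w ++ v) := by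
  have hF := isOverlapFreeLanguage_isThueMorseFactor
  obtain ⟨x, z, hz, hx⟩ := hur.exists_append hF
  obtain ⟨y, z', hz', hy⟩ := hvl.rightExtendable_reverse.exists_append hF.reverse
  obtain ⟨t, ht, hzt⟩ := exists_isThueMorseFactor_append hz hz'
    (2 * ((u ++ x).length + (v.reverse ++ y).length) + 1)
  have hpt : CubeFree (u ++ x ++ t) :=
    hx t (hF.of_infix (List.prefix_append _ _).isInfix hzt)
  have htr : CubeFree (v.reverse ++ y ++ t.reverse) := by
    refine hy t.reverse (hF.of_infix ?_ hzt)
    rw [List.append_assoc]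
    simpa using (List.suffix_append z (t ++ z'.reverse)).isInfix
  refine ⟨x ++ t ++ y.reverse, ?_⟩
  have := hF.cubeFree_glue (r := y.reverse ++ v) hpt (by simpa using htr.reverse)
    (hF.of_infix ⟨z, z'.reverse, rfl⟩ hzt) (by simp at ht ⊢; omega)
  simpa using this
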